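/- All rings are associative with identity and all modules are unital. For an element $a$ of a ring $R$ put $l(a)=\{x\in R: xa=0\}$ and $r(a)=\{x\in R: ax=0\}$. Call $R$ pointwise semicommutative if for every $a\in R$ at least one of $l(a)$, $r(a)$ is a two-sided ideal of $R$; call $R$ left SF if every simple left $R$-module is flat; and call $R$ strongly regular if $a\in a^2R$ for every $a\in R$. Proposition. Let $R$ be a pointwise semicommutative ring. Then $R$ is left SF if and only if $R$ is strongly regular. -/

import Mathlib

open scoped TensorProduct

namespace NCRing

universe u v w w'

/-- A ring `R` is pointwise semicommutative if for every `a` the left annihilator `l(a)` or the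
right annihilator `r(a)` is a two-sided ideal of `R`. -/
def PointwiseSemicommutative (R : Type u) [Ring R] : Prop :=
  ∀ a : R, (∃ I : TwoSidedIdeal R, (I : Set R) = {x : R | x * a = 0}) ∨
    (∃ I : TwoSidedIdeal R, (I : Set R) = {x : R | a * x = 0})

/-- A ring `R` is strongly regular if `a ∈ a²R` for every `a ∈ R`. -/
def StronglyRegular (R : Type u) [Ring R] : Prop :=
  ∀ a : R, ∃ r : R, a = a ^ 2 * r

section Tensor

variable (R : Type u) [Ring R]
variable (N : Type w) [AddCommGroup N] [Module Rᵐᵒᵖ N]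
variable (M : Type v) [AddCommGroup M] [Module R M]

/-- The subgroup of `N ⊗[ℤ] M` generated by the elements `n r ⊗ m - n ⊗ r m`. -/
def balancedRelations : AddSubgroup (N ⊗[ℤ] M) :=
  AddSubgroup.closure
    {t | ∃ (r : R) (n : N) (m : M), t = (MulOpposite.op r • n) ⊗ₜ[ℤ] m - n ⊗ₜ[ℤ] (r • m)}

/-- The tensor product over a (not necessarily commutative) ring `R` of a right `R`-module `N`
(that is, an `Rᵐᵒᵖ`-module) and a left `R`-module `M`; it is an abelian group. -/
abbrev BalancedTensor : Type (max w v) := (N ⊗[ℤ] M) ⧸ balancedRelations R N M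

variable {N} {N' : Type w'} [AddCommGroup N'] [Module Rᵐᵒᵖ N']

theorem balancedRelations_le_comap (f : N →ₗ[Rᵐᵒᵖ] N') :
    balancedRelations R N M ≤ (balancedRelations R N' M).comap
      (LinearMap.rTensor M f.toAddMonoidHom.toIntLinearMap).toAddMonoidHom := by
  refine (AddSubgroup.closure_le _).2 ?_
  rintro _ ⟨r, n, m, rfl⟩
  refine AddSubgroup.subset_closure ⟨r, f n, m, ?_⟩
  simp

/-- The map `f ⊗ id : N ⊗_R M → N' ⊗_R M` induced by a map `f` of right `R`-modules. -/
def BalancedTensor.map (f : N →ₗ[Rᵐᵒᵖ] N') : BalancedTensor R N M →+ BalancedTensor R N' M :=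
  QuotientAddGroup.map _ _ (LinearMap.rTensor M f.toAddMonoidHom.toIntLinearMap).toAddMonoidHom
    (balancedRelations_le_comap R M f)

end Tensor

/-- A left `R`-module `M` is flat if `- ⊗_R M` preserves injectivity of maps of right
`R`-modules. -/
def IsFlat (R : Type u) [Ring R] (M : Type v) [AddCommGroup M] [Module R M] : Prop :=
  ∀ (N N' : Type u) [AddCommGroup N] [AddCommGroup N'] [Module Rᵐᵒᵖ N] [Module Rᵐᵒᵖ N']
    (f : N →ₗ[Rᵐᵒᵖ] N'), Function.Injective f → Function.Injective (BalancedTensor.map R M f)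

/-- A ring `R` is left SF if every simple left `R`-module is flat. -/
def IsLeftSF (R : Type u) [Ring R] : Prop :=
  ∀ (M : Type u) [AddCommGroup M] [Module R M], IsSimpleModule R M → IsFlat R M

end NCRing

/-!
Write `l(a)` and `r(a)` for the left and right annihilators of `a`.

*Tensor products.*  If `M = R m₀` is cyclic and `n ⊗ m₀ = 0` in `N ⊗_R M`, then `n` lies in `N L`,
where `L` is the annihilator of `m₀` (`mem_closure_of_mk_tmul_eq_zero`).  For `M = R ⧸ L` with `L`
a maximal left ideal this turns flatness of `M` into the condition that every `a ∈ L` is of the form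
`a y` with `y ∈ L` (`IsLeftSF.exists_mem_mul_eq`).  Conversely, over a von Neumann regular ring any
two elements of `L` have a common right unit in `L`, so `n ∈ N' L` gives `n = n e` with `e ∈ L` and
`n ⊗ m₀ = n ⊗ e m₀ = 0`; hence every simple module is flat (`isLeftSF_of_regular`).  A strongly
regular ring is von Neumann regular, because it is reduced and `(a - a r a)² = 0` when `a = a² r`.

*From left SF to strongly regular.*  If `r(a)` is a left ideal of a left SF ring, then
`R a + r(a) = R`: a maximal left ideal `L` containing both would contain `y` with `a = a y`, and
also `1 - y ∈ r(a)`.  Hence `a = a t a` for some `t` (`IsLeftSF.exists_eq_mul_mul`).  It remains to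
see that every `r(a)` is a left ideal.  Otherwise `a x = 0 ≠ a u x` for some `x` and `u`, so that
`l(x)` is not an ideal, `r(x)` is one, `x = x t x`, and the idempotent `f = x t` satisfies
`f R (1 - f) = 0`.  The heart of the proof is that then `(1 - f) R f = 0`
(`one_sub_mul_mul_eq_zero`), which contradicts `a u f ≠ 0`.  To see this, let `V = (1 - f) R f`.
For `w ∈ V` and `p ∈ f R f` with `w p ≠ 0`, the left annihilator of `(1 - w) p` is not an ideal;
as `1 - w` is a unit, `r(p)` is one (`rightInsertive_of_mul_ne_zero`).  Applied to the
elements `p` of `f R f` that kill a given `0 ≠ v ∈ V`, and to complementary idempotents `f - h`,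
this shows that `r(v)` is a left ideal, so `v = v t v` for some `t`, and `v t v = 0` since
`f R (1 - f) = 0`.  Finally, when all right annihilators are ideals, all idempotents are central and
`a = (a t) a = a² t`.
-/

namespace NCRing

universe u v w

/-! ### Tensor products with a cyclic module -/

section Tensor

variable {R : Type u} [Ring R]
variable {N : Type w} [AddCommGroup N] [Module Rᵐᵒᵖ N]
variable {M : Type v} [AddCommGroup M] [Module R M]

theorem mk_smul_tmul (r : R) (n : N) (m : M) :
    (((MulOpposite.op r • n) ⊗ₜ[ℤ] m : N ⊗[ℤ] M) : BalancedTensor R N M) =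
      ((n ⊗ₜ[ℤ] (r • m) : N ⊗[ℤ] M) : BalancedTensor R N M) :=
  (QuotientAddGroup.eq_iff_sub_mem).2 (AddSubgroup.subset_closure ⟨r, n, m, rfl⟩)

/-- Half of the isomorphism `N ⊗_R (R ⧸ L) ≃ N ⧸ N L`, for `L` the annihilator of a generator `m₀`:
if `n ⊗ m₀ = 0`, then `n ∈ N L`. -/
theorem mem_closure_of_mk_tmul_eq_zero {m₀ : M} (hm₀ : ∀ m : M, ∃ r : R, r • m₀ = m) {n : N}
    (hn : ((n ⊗ₜ[ℤ] m₀ : N ⊗[ℤ] M) : BalancedTensor R N M) = 0) :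
    n ∈ AddSubgroup.closure {x : N | ∃ (r : R) (n' : N), r • m₀ = 0 ∧ x = MulOpposite.op r • n'} := by
  set S := AddSubgroup.closure
    {x : N | ∃ (r : R) (n' : N), r • m₀ = 0 ∧ x = MulOpposite.op r • n'} with hS
  choose s hs using hm₀
  -- The class of `n' s` modulo `N L` depends only on `s • m₀`.
  have key : ∀ (a b : R) (n' : N), a • m₀ = b • m₀ →
      ((MulOpposite.op a • n' : N) : N ⧸ S) = (MulOpposite.op b • n' : N) := by
    intro a b n' h
    refine (QuotientAddGroup.eq_iff_sub_mem).2 (AddSubgroup.subset_closure ⟨a - b, n', ?_, ?_⟩)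
    · rw [sub_smul, h, sub_self]
    · rw [MulOpposite.op_sub, sub_smul]
  let B : N →+ M →+ N ⧸ S := AddMonoidHom.mk' (fun n' => AddMonoidHom.mk'
      (fun m => ((MulOpposite.op (s m) • n' : N) : N ⧸ S)) (by
        intro m m'
        rw [← QuotientAddGroup.mk_add, ← add_smul, ← MulOpposite.op_add]
        exact key _ _ _ (by rw [hs, add_smul, hs, hs]))) (by
    intro n₁ n₂
    ext m
    simp [smul_add])
  have hB : ∀ n' m, B n' m = ((MulOpposite.op (s m) • n' : N) : N ⧸ S) := fun _ _ => rfl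
  let T : N ⊗[ℤ] M →+ N ⧸ S := TensorProduct.liftAddHom B (by intro r n' m; simp)
  have hT : ∀ n' m, T (n' ⊗ₜ m) = ((MulOpposite.op (s m) • n' : N) : N ⧸ S) := fun _ _ => rfl
  have hle : balancedRelations R N M ≤ T.ker := by
    refine (AddSubgroup.closure_le _).2 ?_
    rintro _ ⟨r, n', m, rfl⟩
    rw [SetLike.mem_coe, AddMonoidHom.mem_ker, map_sub, hT, hT, sub_eq_zero, ← mul_smul,
      ← MulOpposite.op_mul]
    exact key _ _ _ (by rw [hs, mul_smul, hs])
  have h1 : T (n ⊗ₜ m₀) = 0 := hle ((QuotientAddGroup.eq_zero_iff _).1 hn)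
  rw [hT, key (s m₀) 1 n (by rw [hs, one_smul]), MulOpposite.op_one, one_smul] at h1
  exact (QuotientAddGroup.eq_zero_iff _).1 h1

theorem exists_eq_mk_tmul {m₀ : M} (hm₀ : ∀ m : M, ∃ r : R, r • m₀ = m)
    (z : BalancedTensor R N M) :
    ∃ n : N, z = ((n ⊗ₜ[ℤ] m₀ : N ⊗[ℤ] M) : BalancedTensor R N M) := by
  obtain ⟨t, rfl⟩ := QuotientAddGroup.mk_surjective z
  induction t using TensorProduct.induction_on with
  | zero => exact ⟨0, by rw [TensorProduct.zero_tmul]⟩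
  | tmul n m =>
    obtain ⟨r, rfl⟩ := hm₀ m
    exact ⟨MulOpposite.op r • n, (mk_smul_tmul r n m₀).symm⟩
  | add a b ha hb =>
    obtain ⟨n, hn⟩ := ha
    obtain ⟨n', hn'⟩ := hb
    exact ⟨n + n', by rw [QuotientAddGroup.mk_add, hn, hn', TensorProduct.add_tmul,
      QuotientAddGroup.mk_add]⟩

end Tensor

/-! ### Von Neumann regular rings are left SF -/

section Regular

variable {R : Type u} [Ring R]

/-- Two elements of a left ideal of a von Neumann regular ring have a common right unit in it. -/
theorem exists_common_right_unit (h : ∀ a : R, ∃ t, a = a * t * a) (L : Submodule R R)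
    {a b : R} (ha : a ∈ L) (hb : b ∈ L) : ∃ e ∈ L, a * e = a ∧ b * e = b := by
  obtain ⟨t, ht⟩ := h a
  obtain ⟨s, hs⟩ := h (b - b * (t * a))
  set d := b - b * (t * a) with hd
  have hta : t * a ∈ L := L.smul_mem t ha
  have hdL : d ∈ L := L.sub_mem hb (L.smul_mem b hta)
  have hsd : s * d ∈ L := L.smul_mem s hdL
  have h1 : a * (t * a) = a := by rw [← mul_assoc, ← ht]
  have h2 : d * (s * d) = d := by rw [← mul_assoc, ← hs]
  -- The unit `e` is chosen so that `1 - e = (1 - t a) (1 - s d)`.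
  refine ⟨t * a + s * d - t * a * (s * d), L.sub_mem (L.add_mem hta hsd) (L.smul_mem _ hsd), ?_, ?_⟩
  · calc a * (t * a + s * d - t * a * (s * d))
        = a * (t * a) + a * (s * d) - a * (t * a) * (s * d) := by noncomm_ring
      _ = a := by rw [h1]; abel
  · calc b * (t * a + s * d - t * a * (s * d))
        = b * (t * a) + (b - b * (t * a)) * (s * d) := by noncomm_ring
      _ = b := by rw [← hd, h2, hd]; abel

theorem isLeftSF_of_regular (h : ∀ a : R, ∃ t, a = a * t * a) : IsLeftSF R := by
  intro M _ _ hM N N' _ _ _ _ f hf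
  have := IsSimpleModule.nontrivial R M
  obtain ⟨m₀, hne⟩ := exists_ne (0 : M)
  have hm₀ : ∀ m : M, ∃ r : R, r • m₀ = m := IsSimpleModule.toSpanSingleton_surjective R hne
  let L : Submodule R R := LinearMap.ker (LinearMap.toSpanSingleton R M m₀)
  have hL : ∀ r : R, r ∈ L ↔ r • m₀ = 0 := fun r => Iff.rfl
  rw [injective_iff_map_eq_zero]
  intro z hz
  obtain ⟨n, rfl⟩ := exists_eq_mk_tmul hm₀ z
  have hz' : ((f n ⊗ₜ[ℤ] m₀ : N' ⊗[ℤ] M) : BalancedTensor R N' M) = 0 := hz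
  have hmem := mem_closure_of_mk_tmul_eq_zero hm₀ hz'
  have hunit : ∀ x ∈ AddSubgroup.closure {x : N' | ∃ (r : R) (n' : N'), r • m₀ = 0 ∧
      x = MulOpposite.op r • n'}, ∃ e ∈ L, MulOpposite.op e • x = x := by
    intro x hx
    induction hx using AddSubgroup.closure_induction with
    | mem x hx =>
      obtain ⟨r, n', hr, rfl⟩ := hx
      obtain ⟨e, he, hre, -⟩ := exists_common_right_unit h L hr hr
      exact ⟨e, he, by rw [← mul_smul, ← MulOpposite.op_mul, hre]⟩
    | zero => exact ⟨0, L.zero_mem, smul_zero _⟩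
    | add x y _ _ hx hy =>
      obtain ⟨a, ha, hax⟩ := hx
      obtain ⟨b, hb, hby⟩ := hy
      obtain ⟨e, he, hae, hbe⟩ := exists_common_right_unit h L ha hb
      refine ⟨e, he, ?_⟩
      rw [smul_add]
      congr 1
      · rw [← hax, ← mul_smul, ← MulOpposite.op_mul, hae]
      · rw [← hby, ← mul_smul, ← MulOpposite.op_mul, hbe]
    | neg x _ hx =>
      obtain ⟨e, he, hex⟩ := hx
      exact ⟨e, he, by rw [smul_neg, hex]⟩
  obtain ⟨e, he, hen⟩ := hunit _ hmem
  have hn : MulOpposite.op e • n = n := hf (by rw [map_smul, hen])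
  rw [← hn, mk_smul_tmul, (hL e).1 he, TensorProduct.tmul_zero]
  rfl

theorem StronglyRegular.exists_eq_mul_mul (h : StronglyRegular R) (a : R) :
    ∃ t, a = a * t * a := by
  have hred : ∀ b : R, b * b = 0 → b = 0 := by
    intro b hb
    obtain ⟨r, hr⟩ := h b
    rw [hr, pow_two, hb, zero_mul]
  obtain ⟨r, hr⟩ := h a
  have hr' : a * a * r = a := by rw [← pow_two, ← hr]
  refine ⟨r, sub_eq_zero.1 (hred _ ?_)⟩
  calc (a - a * r * a) * (a - a * r * a)
      = a * a - a * a * r * a - a * r * (a * a) + a * r * (a * a * r) * a := by noncomm_ring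
    _ = 0 := by rw [hr']; noncomm_ring

end Regular

/-! ### Left SF rings -/

section LeftSF

variable {R : Type u} [Ring R]

/-- Flatness of `R ⧸ L`, tested on the inclusion of the right ideal `a R` into `R`. -/
theorem IsLeftSF.exists_mem_mul_eq (h : IsLeftSF R) {L : Submodule R R} (hL : IsCoatom L) {a : R}
    (ha : a ∈ L) : ∃ y ∈ L, a * y = a := by
  have hflat := h (R ⧸ L) (isSimpleModule_iff_isCoatom.2 hL)
  let N : Submodule Rᵐᵒᵖ R := Submodule.span Rᵐᵒᵖ {a}
  have hinj := hflat N R N.subtype N.injective_subtype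
  let a' : N := ⟨a, Submodule.mem_span_singleton_self a⟩
  let m₀ : R ⧸ L := Submodule.Quotient.mk 1
  have hsmul : ∀ r : R, r • m₀ = Submodule.Quotient.mk r := by
    intro r
    rw [← Submodule.Quotient.mk_smul, smul_eq_mul, mul_one]
  have hm₀ : ∀ m : R ⧸ L, ∃ r : R, r • m₀ = m := by
    intro m
    obtain ⟨r, rfl⟩ := Submodule.Quotient.mk_surjective L m
    exact ⟨r, hsmul r⟩
  have hR : ((a ⊗ₜ[ℤ] m₀ : R ⊗[ℤ] (R ⧸ L)) : BalancedTensor R R (R ⧸ L)) = 0 := by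
    have := mk_smul_tmul a (1 : R) m₀
    rw [hsmul, (Submodule.Quotient.mk_eq_zero L).2 ha, TensorProduct.tmul_zero,
      op_smul_eq_mul, one_mul] at this
    exact this
  have hN : ((a' ⊗ₜ[ℤ] m₀ : N ⊗[ℤ] (R ⧸ L)) : BalancedTensor R N (R ⧸ L)) = 0 :=
    hinj (by rw [map_zero]; exact hR)
  have hmem := mem_closure_of_mk_tmul_eq_zero hm₀ hN
  have hall : ∀ z ∈ AddSubgroup.closure {x : N | ∃ (r : R) (n : N), r • m₀ = 0 ∧
      x = MulOpposite.op r • n}, ∃ y ∈ L, a * y = (z : R) := by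
    intro z hz
    induction hz using AddSubgroup.closure_induction with
    | mem x hx =>
      obtain ⟨r, n, hr, rfl⟩ := hx
      rw [hsmul, Submodule.Quotient.mk_eq_zero] at hr
      obtain ⟨s, hs⟩ := Submodule.mem_span_singleton.1 n.2
      refine ⟨s.unop * r, L.smul_mem _ hr, ?_⟩
      rw [Submodule.coe_smul, ← hs, ← mul_assoc]
      rfl
    | zero => exact ⟨0, L.zero_mem, by simp⟩
    | add x y _ _ hx hy =>
      obtain ⟨b, hb, hbx⟩ := hx
      obtain ⟨c, hc, hcy⟩ := hy
      exact ⟨b + c, L.add_mem hb hc, by rw [mul_add, hbx, hcy]; rfl⟩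
    | neg x _ hx =>
      obtain ⟨b, hb, hbx⟩ := hx
      exact ⟨-b, L.neg_mem hb, by rw [mul_neg, hbx]; rfl⟩
  exact hall a' hmem

/-- The right annihilator of `a` is a left (hence a two-sided) ideal. -/
def RightInsertive (a : R) : Prop := ∀ x, a * x = 0 → ∀ s, a * s * x = 0

/-- The left annihilator of `a` is a right (hence a two-sided) ideal. -/
def LeftInsertive (a : R) : Prop := ∀ x, x * a = 0 → ∀ s, x * s * a = 0

theorem PointwiseSemicommutative.leftInsertive_or_rightInsertive
    (h : PointwiseSemicommutative R) (a : R) : LeftInsertive a ∨ RightInsertive a := by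
  rcases h a with ⟨I, hI⟩ | ⟨I, hI⟩
  · left
    intro x hx s
    have hxI : x ∈ (I : Set R) := by rw [hI]; exact hx
    have : x * s ∈ (I : Set R) := I.mul_mem_right x s hxI
    rwa [hI] at this
  · right
    intro x hx s
    have hxI : x ∈ (I : Set R) := by rw [hI]; exact hx
    have : s * x ∈ (I : Set R) := I.mul_mem_left s x hxI
    rw [hI] at this
    rw [mul_assoc]
    exact this

/-- In a left SF ring, `R a + r(a) = R` as soon as `r(a)` is a left ideal. -/
theorem IsLeftSF.exists_eq_mul_mul (h : IsLeftSF R) {a : R} (ha : RightInsertive a) :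
    ∃ t, a = a * t * a := by
  let A : Submodule R R :=
    { carrier := {x | a * x = 0}
      zero_mem' := mul_zero a
      add_mem' := fun {x y} hx hy => by
        change a * (x + y) = 0
        rw [mul_add, show a * x = 0 from hx, show a * y = 0 from hy, add_zero]
      smul_mem' := fun s x hx => by
        change a * (s * x) = 0
        rw [← mul_assoc]
        exact ha x hx s }
  have htop : Submodule.span R {a} ⊔ A = ⊤ := by
    by_contra hne
    obtain ⟨L, hL, hle⟩ := (eq_top_or_exists_le_coatom (Submodule.span R {a} ⊔ A)).resolve_left hne
    have haL : a ∈ L := hle (Submodule.mem_sup_left (Submodule.mem_span_singleton_self a))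
    obtain ⟨y, hy, hay⟩ := h.exists_mem_mul_eq hL haL
    have h1 : 1 - y ∈ L := hle (Submodule.mem_sup_right (show a * (1 - y) = 0 by
      rw [mul_sub, hay, mul_one, sub_self]))
    have h2 : (1 : R) ∈ L := by simpa using L.add_mem h1 hy
    exact hL.1 ((Ideal.eq_top_iff_one L).2 h2)
  have hone : (1 : R) ∈ Submodule.span R {a} ⊔ A := htop ▸ Submodule.mem_top
  obtain ⟨b, hb, x, hx, hbx⟩ := Submodule.mem_sup.1 hone
  obtain ⟨t, rfl⟩ := Submodule.mem_span_singleton.1 hb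
  refine ⟨t, ?_⟩
  calc a = a * (t • a + x) := by rw [hbx, mul_one]
    _ = a * t * a := by
      rw [mul_add, show a * x = 0 from hx, add_zero, smul_eq_mul, mul_assoc]

end LeftSF

/-! ### Pointwise semicommutative left SF rings -/

section Semicommutative

variable {R : Type u} [Ring R]

/-- The left annihilator of `(1 - w) p` contains `w + (1 - f)` but not `(w + (1 - f)) w = w`, so the
right annihilator of `(1 - w) p`, which is that of `p`, must be an ideal. -/
theorem rightInsertive_of_mul_ne_zero (hR : PointwiseSemicommutative R) {f w p : R}
    (hfw : f * w = 0) (hwf : w * f = w) (hfp : f * p = p) (hwp : w * p ≠ 0) :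
    RightInsertive p := by
  have hww : w * w = 0 := by
    calc w * w = w * f * w := by rw [hwf]
      _ = 0 := by rw [mul_assoc, hfw, mul_zero]
  rcases hR.leftInsertive_or_rightInsertive ((1 - w) * p) with hl | hr
  · refine absurd ?_ hwp
    have h0 : (w + (1 - f)) * ((1 - w) * p) = 0 := by
      calc (w + (1 - f)) * ((1 - w) * p)
          = w * p - w * w * p + (p - f * p) - w * p + f * w * p := by noncomm_ring
        _ = 0 := by rw [hww, hfp, hfw]; noncomm_ring
    calc w * p = (w * w + w - f * w) * p - (w * w + w - f * w) * w * p := by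
          rw [hww, hfw]; simp [hww]
      _ = (w + (1 - f)) * w * ((1 - w) * p) := by noncomm_ring
      _ = 0 := hl _ h0 w
  · intro x hx s
    have h1 : (1 - w) * p * s * x = 0 := hr x (by rw [mul_assoc, hx, mul_zero]) s
    calc p * s * x = (1 + w) * ((1 - w) * p * s * x) + w * w * (p * s * x) := by noncomm_ring
      _ = 0 := by rw [h1, hww, mul_zero, zero_mul, add_zero]

/-- For an idempotent `f`, if `f R (1 - f) = 0` then `(1 - f) R f = 0`. -/
theorem one_sub_mul_mul_eq_zero (hR : PointwiseSemicommutative R) (hSF : IsLeftSF R) {f : R}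
    (hff : f * f = f) (hf : ∀ x, f * x = f * x * f) (x : R) : (1 - f) * x * f = 0 := by
  set v := (1 - f) * x * f with hv
  have hfv : f * v = 0 := by
    calc f * v = (f - f * f) * x * f := by rw [hv]; noncomm_ring
      _ = 0 := by rw [hff, sub_self, zero_mul, zero_mul]
  have hvf : v * f = v := by rw [hv, mul_assoc, hff]
  by_contra hv0
  have hins : RightInsertive v := by
    intro y hy s
    -- Only the component `p ∈ f R f` of `y` matters.
    set p := f * y with hp
    have hfp : f * p = p := by rw [hp, ← mul_assoc, hff]
    have hvp : v * p = 0 := by rw [hp, ← mul_assoc, hvf, hy]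
    have hvsf : v * s = v * s * f := by
      calc v * s = v * (f * s) := by rw [← mul_assoc, hvf]
        _ = v * s * f := by rw [hf s, ← mul_assoc, ← mul_assoc, hvf]
    have hgoal : v * s * y = v * s * p := by rw [hp, ← mul_assoc, ← hvsf]
    rw [hgoal]
    by_contra hne
    have hfvs : f * (v * s) = 0 := by rw [← mul_assoc, hfv, zero_mul]
    obtain ⟨t, ht⟩ := hSF.exists_eq_mul_mul
      (rightInsertive_of_mul_ne_zero hR hfvs hvsf.symm hfp hne)
    set h := p * t * f with hh
    have hhp : h * p = p := by rw [hh, mul_assoc, hfp, ← ht]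
    have hhh : h * h = h := by
      calc h * h = h * p * (t * f) := by rw [hh]; noncomm_ring
        _ = h := by rw [hhp, ← mul_assoc]
    have hfh : f * h = h := by rw [hh, ← mul_assoc, ← mul_assoc, hfp]
    have hvh : v * h = 0 := by rw [hh, ← mul_assoc, ← mul_assoc, hvp, zero_mul, zero_mul]
    have hq : RightInsertive (f - h) := by
      refine rightInsertive_of_mul_ne_zero hR hfv hvf ?_ ?_
      · rw [mul_sub, hff, hfh]
      · rw [mul_sub, hvf, hvh, sub_zero]
        exact hv0
    have h1 : (f - h) * s * h = 0 := hq h (by rw [sub_mul, hfh, hhh, sub_self]) s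
    refine hne ?_
    calc v * s * p = v * f * s * (h * p) := by rw [hhp, hvf]
      _ = v * ((f - h) * s * h) * p + v * h * (s * h * p) := by noncomm_ring
      _ = 0 := by rw [h1, hvh, mul_zero, zero_mul, zero_mul, add_zero]
  obtain ⟨t, ht⟩ := hSF.exists_eq_mul_mul hins
  refine hv0 ?_
  calc v = v * f * t * v := by rw [hvf]; exact ht
    _ = v * (f * t) * v := by rw [mul_assoc v]
    _ = 0 := by rw [hf t, mul_assoc, mul_assoc _ f v, hfv, mul_zero, mul_zero]

theorem rightInsertive (hR : PointwiseSemicommutative R) (hSF : IsLeftSF R) (a : R) :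
    RightInsertive a := by
  intro x hx u
  by_contra hne
  have hxr : RightInsertive x := (hR.leftInsertive_or_rightInsertive x).resolve_left
    fun hl => hne (hl a hx u)
  obtain ⟨t, ht⟩ := hSF.exists_eq_mul_mul hxr
  set f := x * t with hfdef
  have hff : f * f = f := by rw [hfdef, ← mul_assoc, ← ht]
  have haf : a * f = 0 := by rw [hfdef, ← mul_assoc, hx, zero_mul]
  have hauf : a * u * f ≠ 0 := fun h0 => hne (by rw [ht, ← mul_assoc, h0, zero_mul])
  have hfr : RightInsertive f := (hR.leftInsertive_or_rightInsertive f).resolve_left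
    fun hl => hauf (hl a haf u)
  have hf : ∀ y, f * y = f * y * f := by
    intro y
    have := hfr (1 - f) (by rw [mul_sub, hff, mul_one, sub_self]) y
    rw [mul_sub, mul_one] at this
    exact sub_eq_zero.1 this
  refine hauf ?_
  calc a * u * f = a * ((1 - f) * u * f) + a * f * (u * f) := by noncomm_ring
    _ = 0 := by rw [one_sub_mul_mul_eq_zero hR hSF hff hf, haf, mul_zero, zero_mul, add_zero]

theorem stronglyRegular_of_isLeftSF (hR : PointwiseSemicommutative R) (hSF : IsLeftSF R) :
    StronglyRegular R := by
  intro a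
  obtain ⟨t, ht⟩ := hSF.exists_eq_mul_mul (rightInsertive hR hSF a)
  set e := a * t with he
  have hee : e * e = e := by rw [he, ← mul_assoc, ← ht]
  -- The idempotent `e` commutes with `a`, since both `r(e)` and `r(1 - e)` are ideals.
  have h1 : e * a * (1 - e) = 0 :=
    rightInsertive hR hSF e (1 - e) (by rw [mul_sub, hee, mul_one, sub_self]) a
  have h2 : (1 - e) * a * e = 0 :=
    rightInsertive hR hSF (1 - e) e (by rw [sub_mul, hee, one_mul, sub_self]) a
  refine ⟨t, ?_⟩
  calc a = e * a := ht
    _ = a * e + e * a * (1 - e) - (1 - e) * a * e := by noncomm_ring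
    _ = a ^ 2 * t := by rw [h1, h2, add_zero, sub_zero, he, ← mul_assoc, pow_two]

end Semicommutative

end NCRing

theorem mainTheorem1 {R : Type*} [Ring R] (hR : NCRing.PointwiseSemicommutative R) :
    NCRing.IsLeftSF R ↔ NCRing.StronglyRegular R :=
  ⟨NCRing.stronglyRegular_of_isLeftSF hR, fun h => NCRing.isLeftSF_of_regular h.exists_eq_mul_mul⟩
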